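/- Let $d \ge 3$ and $0<\alpha<1$. A bounded domain is a nonempty, bounded, connected open set $\Omega\subset\mathbb R^d$; it has $C^k$ boundary if every $x_0\in\partial\Omega$ has an open neighbourhood $U$ and a $C^k$ function $\varphi:U\to\mathbb R$ with $\nabla\varphi(x_0)\neq 0$ and $\Omega\cap U=\{\varphi<0\}$. For such a domain (with $k\ge 2$) let $\nu$ be the outward unit normal and $\mathrm{II}_{\partial\Omega}(v,w)=\langle D_v\nu,w\rangle$ the second fundamental form of $\partial\Omega$ (so that it is positive definite for balls), and consider the condition $$\mathrm{II}_{\partial\Omega}(v,v)\;\ge\;(1-\alpha)\,\frac{x\cdot\nu(x)}{|x|^2}\,|v|^2\qquad\text{for all }x\in\partial\Omega\text{ and all }v\in T_x\partial\Omega. \tag{$*$}$$ (i) If $\Omega\subset\mathbb R^d$ is a bounded domain with $C^2$ boundary that satisfies $(*)$ and the origin $O$ lies in $\Omega$, then $\Omega$ is convex. (ii) Among the bounded domains that satisfy $(*)$ and whose closure does not contain $O$ there are both convex and nonconvex ones: there exist a convex bounded domain and a nonconvex bounded domain in $\mathbb R^d$, both with $C^\infty$ boundary, with $O\notin\overline\Omega$,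 and satisfying $(*)$. -/

import Mathlib

open scoped ContDiff

namespace CurvatureCondition

variable {E : Type*} [NormedAddCommGroup E] [InnerProductSpace ℝ E]

/-- `φ` is a defining function of class `C^n` of the set `Ω` on the open set `U`:
`Ω ∩ U = {φ < 0} ∩ U`. (Nondegeneracy at the boundary is required separately.) -/
def IsDefiningFunctionOn (n : WithTop ℕ∞) (Ω U : Set E) (φ : E → ℝ) : Prop :=
  IsOpen U ∧ ContDiffOn ℝ n φ U ∧ ∀ y ∈ U, (y ∈ Ω ↔ φ y < 0)

/-- `Ω` is a bounded domain (nonempty, open, connected) with boundary of class `C^n`: near each of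
its boundary points, `Ω` is the sublevel set `{φ < 0}` of a `C^n` function `φ` with nonvanishing
differential at that point. -/
structure IsBoundedDomain (n : WithTop ℕ∞) (Ω : Set E) : Prop where
  isOpen : IsOpen Ω
  isConnected : IsConnected Ω
  isBounded : Bornology.IsBounded Ω
  boundary : ∀ x ∈ frontier Ω, ∃ (U : Set E) (φ : E → ℝ),
    x ∈ U ∧ IsDefiningFunctionOn n Ω U φ ∧ fderiv ℝ φ x ≠ 0

/-- `ν` is the outward unit normal to `Ω` at the boundary point `x`: it has unit length, every ray
from `x` that makes an obtuse angle with `ν` starts inside `Ω`, and every ray that makes an acute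
angle with `ν` starts outside the closure of `Ω`. There is at most one such vector, and for
a domain with `C^1` boundary it is the normalized gradient of a defining function. -/
def IsOutwardUnitNormal (Ω : Set E) (x ν : E) : Prop :=
  ‖ν‖ = 1 ∧
  (∀ v : E, inner ℝ v ν < 0 → ∀ᶠ t : ℝ in nhdsWithin 0 (Set.Ioi 0), x + t • v ∈ Ω) ∧
  (∀ v : E, 0 < inner ℝ v ν → ∀ᶠ t : ℝ in nhdsWithin 0 (Set.Ioi 0), x + t • v ∉ closure Ω)

/-- The outward unit normal field `ν` of `∂Ω`. -/
noncomputable def outwardNormal (Ω : Set E) (x : E) : E :=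
  Classical.epsilon (IsOutwardUnitNormal Ω x)

/-- The second fundamental form of `∂Ω` at `x`, for tangent vectors `v`, `w`, with the sign for
which balls have positive second fundamental form: `II(v, w) = ⟨D_v ν, w⟩`, where `D_v ν` is the
derivative along `∂Ω` of the outward unit normal field. -/
noncomputable def secondFundamentalForm (Ω : Set E) (x v w : E) : ℝ :=
  inner ℝ (fderivWithin ℝ (outwardNormal Ω) (frontier Ω) x v) w

/-- The condition `II_{∂Ω} ≥ (1 - α) (x · ν) / |x|²` on `∂Ω`, as an inequality of quadratic forms
on the tangent spaces `T_x ∂Ω = ν(x)^⊥` (the right-hand side is a multiple of the metric). -/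
def SatisfiesCondition (α : ℝ) (Ω : Set E) : Prop :=
  ∀ x ∈ frontier Ω, ∀ v : E, inner ℝ v (outwardNormal Ω x) = 0 →
    (1 - α) * (inner ℝ x (outwardNormal Ω x) / ‖x‖ ^ 2) * ‖v‖ ^ 2
      ≤ secondFundamentalForm Ω x v v

/-! Well-definedness: the normal is unique, it is the normalized gradient of any defining function,
and the second fundamental form is the normalized Hessian of any defining function. -/

theorem IsOutwardUnitNormal.unique {Ω : Set E} {x ν ν' : E}
    (h : IsOutwardUnitNormal Ω x ν) (h' : IsOutwardUnitNormal Ω x ν') : ν = ν' := by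
  by_contra hne
  have hlt : inner ℝ ν ν' < 1 := (inner_lt_one_iff_real_of_norm_eq_one h.1 h'.1).2 hne
  have h1 : inner ℝ (ν' - ν) ν < 0 := by
    rw [inner_sub_left, real_inner_self_eq_norm_sq, h.1, real_inner_comm]; linarith
  have h2 : 0 < inner ℝ (ν' - ν) ν' := by
    rw [inner_sub_left, real_inner_self_eq_norm_sq, h'.1]; linarith
  obtain ⟨t, ht1, ht2⟩ := ((h.2.1 _ h1).and (h'.2.2 _ h2)).exists
  exact ht2 (subset_closure ht1)

theorem IsOutwardUnitNormal.outwardNormal_eq {Ω : Set E} {x ν : E}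
    (h : IsOutwardUnitNormal Ω x ν) : outwardNormal Ω x = ν :=
  (Classical.epsilon_spec (p := IsOutwardUnitNormal Ω x) ⟨ν, h⟩).unique h

theorem IsOutwardUnitNormal.mem_tangentConeAt {Ω : Set E} {x ν v : E}
    (h : IsOutwardUnitNormal Ω x ν) (hv : inner ℝ v ν = 0) :
    v ∈ tangentConeAt ℝ (frontier Ω) x := by
  have key : ∀ k : ℕ, ∃ t : ℝ, ∃ s : ℝ, 0 < t ∧ t < 1 / ((k : ℝ) + 1) ∧ |s| ≤ 1 / ((k : ℝ) + 1) ∧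
      x + t • (v + s • ν) ∈ frontier Ω := by
    intro k
    set ε : ℝ := 1 / ((k : ℝ) + 1) with hε
    have hεp : 0 < ε := by positivity
    have h1 : inner ℝ (v + (-ε) • ν) ν < 0 := by
      rw [inner_add_left, hv, real_inner_smul_left, real_inner_self_eq_norm_sq, h.1]; linarith
    have h2 : 0 < inner ℝ (v + ε • ν) ν := by
      rw [inner_add_left, hv, real_inner_smul_left, real_inner_self_eq_norm_sq, h.1]; linarith
    have h3 : ∀ᶠ t : ℝ in nhdsWithin 0 (Set.Ioi 0), t ∈ Set.Ioo 0 ε :=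
      Ioo_mem_nhdsGT hεp
    obtain ⟨t, ⟨ht1, ht2⟩, ht3⟩ := (((h.2.1 _ h1).and (h.2.2 _ h2)).and h3).exists
    have hc : IsPreconnected ((fun s : ℝ => x + t • (v + s • ν)) '' Set.Icc (-ε) ε) :=
      isPreconnected_Icc.image _ (by fun_prop)
    by_contra hno
    push Not at hno
    have hsub : (fun s : ℝ => x + t • (v + s • ν)) '' Set.Icc (-ε) ε ⊆
        interior Ω ∪ (closure Ω)ᶜ := by
      rintro _ ⟨s, hs, rfl⟩
      have := hno t s ht3.1 ht3.2 (abs_le.2 hs)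
      by_cases hcl : x + t • (v + s • ν) ∈ closure Ω
      · left
        by_contra hi
        exact this ⟨hcl, hi⟩
      · exact Or.inr hcl
    have hnot := hsub ⟨-ε, ⟨le_refl _, by linarith⟩, rfl⟩
    obtain ⟨z, -, hz1, hz2⟩ := hc _ _ isOpen_interior isClosed_closure.isOpen_compl hsub
      ⟨_, ⟨-ε, ⟨le_refl _, by linarith⟩, rfl⟩, hnot.resolve_right
        (fun hh => hh (subset_closure ht1))⟩
      ⟨_, ⟨ε, ⟨by linarith, le_refl _⟩, rfl⟩, ht2⟩
    exact hz2 (subset_closure (interior_subset hz1))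
  choose t s ht0 ht1 hs hmem using key
  have hlim : Filter.Tendsto (fun k : ℕ => 1 / ((k : ℝ) + 1)) Filter.atTop (nhds 0) :=
    tendsto_one_div_add_atTop_nhds_zero_nat
  have hs0 : Filter.Tendsto s Filter.atTop (nhds 0) :=
    squeeze_zero_norm (fun k => by simpa using hs k) hlim
  have ht0' : Filter.Tendsto t Filter.atTop (nhds 0) :=
    squeeze_zero (fun k => (ht0 k).le) (fun k => (ht1 k).le) hlim
  have hvs : Filter.Tendsto (fun k => v + s k • ν) Filter.atTop (nhds v) := by
    simpa using (tendsto_const_nhds (x := v)).add (hs0.smul_const ν)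
  refine mem_tangentConeAt_of_seq Filter.atTop (fun k => (t k)⁻¹)
    (fun k => t k • (v + s k • ν)) ?_ (Filter.Eventually.of_forall hmem) ?_
  · simpa using ht0'.smul hvs
  · refine hvs.congr fun k => ?_
    rw [smul_smul, inv_mul_cancel₀ (ht0 k).ne', one_smul]

variable [CompleteSpace E] {n : WithTop ℕ∞} {Ω U : Set E} {φ : E → ℝ} {x : E}

theorem IsDefiningFunctionOn.isOutwardUnitNormal (h : IsDefiningFunctionOn n Ω U φ) (hn : 1 ≤ n)
    (hΩ : IsOpen Ω) (hx : x ∈ frontier Ω) (hxU : x ∈ U) (hφ : fderiv ℝ φ x ≠ 0) :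
    IsOutwardUnitNormal Ω x (‖gradient φ x‖⁻¹ • gradient φ x) := by
  obtain ⟨hU, hC, hdef⟩ := h
  have hcont : ContinuousOn φ U := hC.continuousOn
  have hdiff : DifferentiableAt ℝ φ x :=
    (hC.contDiffAt (hU.mem_nhds hxU)).differentiableAt (by
      intro h0; rw [h0] at hn; simp at hn)
  have hpos : ∀ y ∈ U, 0 < φ y → y ∉ closure Ω := by
    intro y hy hlt hcl
    have hnb : {z | z ∈ U ∧ 0 < φ z} ∈ nhds y :=
      (hU.eventually_mem hy).and ((hcont.continuousAt (hU.mem_nhds hy)).eventually_const_lt hlt)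
    obtain ⟨z, hz, hzΩ⟩ := mem_closure_iff_nhds.1 hcl _ hnb
    exact absurd ((hdef z hz.1).1 hzΩ) (not_lt.2 hz.2.le)
  have hx0 : φ x = 0 := by
    have h1 : x ∉ Ω := by
      rw [hΩ.frontier_eq] at hx; exact hx.2
    have h2 : ¬ φ x < 0 := fun hh => h1 ((hdef x hxU).2 hh)
    have h3 : ¬ 0 < φ x := fun hh => hpos x hxU hh hx.1
    linarith
  have hg : gradient φ x ≠ 0 := by
    simpa [gradient] using hφ
  have hgn : 0 < ‖gradient φ x‖ := norm_pos_iff.2 hg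
  have hin : ∀ v : E, inner ℝ v (‖gradient φ x‖⁻¹ • gradient φ x)
      = ‖gradient φ x‖⁻¹ * fderiv ℝ φ x v := by
    intro v
    rw [real_inner_smul_right, real_inner_comm, gradient, InnerProductSpace.toDual_symm_apply]
  have hline : ∀ v : E, HasDerivAt (fun t : ℝ => φ (x + t • v)) (fderiv ℝ φ x v) 0 := by
    intro v
    have h1 : HasDerivAt (fun t : ℝ => x + t • v) v 0 := by
      simpa using ((hasDerivAt_id (0 : ℝ)).smul_const v).const_add x
    have h2 : HasFDerivAt φ (fderiv ℝ φ x) (x + (0 : ℝ) • v) := by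
      simpa using hdiff.hasFDerivAt
    exact h2.comp_hasDerivAt (0 : ℝ) h1
  have hmem : ∀ v : E, ∀ᶠ t : ℝ in nhdsWithin 0 (Set.Ioi 0), x + t • v ∈ U := by
    intro v
    have : Filter.Tendsto (fun t : ℝ => x + t • v) (nhdsWithin 0 (Set.Ioi 0)) (nhds x) := by
      have h1 : Continuous (fun t : ℝ => x + t • v) := by fun_prop
      have := (h1.tendsto 0).mono_left (nhdsWithin_le_nhds (s := Set.Ioi 0))
      simpa using this
    exact this.eventually (hU.eventually_mem hxU)
  have hslope : ∀ v : E, Filter.Tendsto (fun t : ℝ => t⁻¹ * φ (x + t • v))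
      (nhdsWithin 0 (Set.Ioi 0)) (nhds (fderiv ℝ φ x v)) := by
    intro v
    have := (hline v).tendsto_slope_zero_right
    simpa [hx0] using this
  refine ⟨?_, ?_, ?_⟩
  · rw [norm_smul, norm_inv, norm_norm, inv_mul_cancel₀ hgn.ne']
  · intro v hv
    rw [hin] at hv
    have hv' : fderiv ℝ φ x v < 0 := by
      by_contra hh
      exact absurd hv (not_lt.2 (mul_nonneg (by positivity) (not_lt.1 hh)))
    filter_upwards [hmem v, (hslope v).eventually_lt_const hv', self_mem_nhdsWithin]
      with t htU ht ht0
    refine (hdef _ htU).2 ?_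
    by_contra hh
    exact absurd ht (not_lt.2 (mul_nonneg (inv_nonneg.2 (le_of_lt ht0)) (not_lt.1 hh)))
  · intro v hv
    rw [hin] at hv
    have hv' : 0 < fderiv ℝ φ x v := pos_of_mul_pos_right hv (by positivity)
    filter_upwards [hmem v, (hslope v).eventually_const_lt hv', self_mem_nhdsWithin]
      with t htU ht ht0
    exact hpos _ htU (pos_of_mul_pos_right ht (inv_nonneg.2 (le_of_lt ht0)))

theorem IsDefiningFunctionOn.outwardNormal_eq (h : IsDefiningFunctionOn n Ω U φ) (hn : 1 ≤ n)
    (hΩ : IsOpen Ω) (hx : x ∈ frontier Ω) (hxU : x ∈ U) (hφ : fderiv ℝ φ x ≠ 0) :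
    outwardNormal Ω x = ‖gradient φ x‖⁻¹ • gradient φ x :=
  (h.isOutwardUnitNormal hn hΩ hx hxU hφ).outwardNormal_eq

theorem IsDefiningFunctionOn.secondFundamentalForm_eq (h : IsDefiningFunctionOn n Ω U φ)
    (hn : 2 ≤ n) (hΩ : IsOpen Ω) (hx : x ∈ frontier Ω) (hxU : x ∈ U) (hφ : fderiv ℝ φ x ≠ 0)
    {v w : E} (hv : fderiv ℝ φ x v = 0) (hw : fderiv ℝ φ x w = 0) :
    secondFundamentalForm Ω x v w = fderiv ℝ (fderiv ℝ φ) x v w / ‖fderiv ℝ φ x‖ := by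
  have hn1 : (1 : WithTop ℕ∞) ≤ n := le_trans (by norm_num) hn
  have hν := h.isOutwardUnitNormal hn1 hΩ hx hxU hφ
  have hCx : ContDiffAt ℝ 2 φ x := (h.2.1.contDiffAt (h.1.mem_nhds hxU)).of_le hn
  have hD : ContDiffAt ℝ 1 (fderiv ℝ φ) x := hCx.fderiv_right (by norm_num)
  have hDd : HasFDerivAt (fderiv ℝ φ) (fderiv ℝ (fderiv ℝ φ) x) x :=
    (hD.differentiableAt (by norm_num)).hasFDerivAt
  have hg : gradient φ x ≠ 0 := by
    simpa [gradient] using hφ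
  -- the gradient and its derivative
  let T : StrongDual ℝ E →L[ℝ] E :=
    { toFun := (InnerProductSpace.toDual ℝ E).symm
      map_add' := by simp
      map_smul' := by simp
      cont := (InnerProductSpace.toDual ℝ E).symm.continuous }
  set L : E →L[ℝ] E := T.comp (fderiv ℝ (fderiv ℝ φ) x) with hL
  have hgd : HasFDerivAt (gradient φ) L x :=
    T.hasFDerivAt.comp x hDd
  have hLw : inner ℝ (L v) w = fderiv ℝ (fderiv ℝ φ) x v w := by
    exact InnerProductSpace.toDual_symm_apply
  have hgw : inner ℝ (gradient φ x) w = 0 := by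
    rw [gradient, InnerProductSpace.toDual_symm_apply, hw]
  have hnorm : ‖gradient φ x‖ = ‖fderiv ℝ φ x‖ := by
    simp [gradient]
  -- the normalized gradient is differentiable
  have hinv : DifferentiableAt ℝ (fun y => ‖gradient φ y‖⁻¹) x :=
    (hgd.differentiableAt.norm ℝ hg).inv (norm_ne_zero_iff.2 hg)
  have hN : HasFDerivAt (fun y => ‖gradient φ y‖⁻¹ • gradient φ y)
      (‖gradient φ x‖⁻¹ • L +
        (fderiv ℝ (fun y => ‖gradient φ y‖⁻¹) x).smulRight (gradient φ x)) x :=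
    hinv.hasFDerivAt.smul hgd
  have hev : outwardNormal Ω =ᶠ[nhdsWithin x (frontier Ω)]
      fun y => ‖gradient φ y‖⁻¹ • gradient φ y := by
    have h1 : ∀ᶠ y in nhds x, y ∈ U ∧ fderiv ℝ φ y ≠ 0 :=
      (h.1.eventually_mem hxU).and (hD.continuousAt.eventually_ne hφ)
    filter_upwards [nhdsWithin_le_nhds h1, self_mem_nhdsWithin] with y hy hyf
    exact h.outwardNormal_eq hn1 hΩ hyf hy.1 hy.2
  have hνd := hN.hasFDerivWithinAt.congr_of_eventuallyEq (s := frontier Ω) hev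
    (h.outwardNormal_eq hn1 hΩ hx hxU hφ)
  have hvt : inner ℝ v (‖gradient φ x‖⁻¹ • gradient φ x) = 0 := by
    rw [real_inner_smul_right, real_inner_comm, gradient, InnerProductSpace.toDual_symm_apply,
      hv, mul_zero]
  have heq := hνd.differentiableWithinAt.hasFDerivWithinAt.unique_on hνd
    (hν.mem_tangentConeAt hvt)
  rw [secondFundamentalForm, heq]
  simp only [add_apply, smul_apply, ContinuousLinearMap.smulRight_apply, inner_add_left,
    real_inner_smul_left, hLw, hgw, hnorm]
  rw [mul_zero, add_zero, div_eq_inv_mul]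

end CurvatureCondition

namespace CurvatureCondition

variable {E : Type*} [NormedAddCommGroup E] [InnerProductSpace ℝ E]

/-! Convexity for `O ∈ Ω` comes from one maximum principle, used twice. Let `κ ≥ 0` be locally
bounded near `∂Ω` with `II ≥ κ ⟨z - p, ν⟩`. If a line through `p` touches `∂Ω` from inside at `y`,
then `z - p` is tangent at `z = y`, and for slight bendings of the line the lower bound is
controlled by their slope. An exponential barrier beats such a term, so contact persists along the
line (`eventually_notMem_of_touching`). Hence a segment from `p ∈ Ω` that stays in the closure and
ends in `Ω` cannot touch `∂Ω`, and connectedness makes `Ω` star-shaped about `p`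
(`IsBoundedDomain.starConvex`). For `p = O` and `κ = (1 - α)/|z|²` the hypothesis is the curvature
condition. Star-shapedness about `O` gives `x · ν ≥ 0`, so the condition yields `II ≥ 0`. Then `κ =
0` serves for every `p ∈ Ω`, and a set star-shaped about each of its points is convex.

Away from `O`, a distant unit ball is a convex example. For a nonconvex one put `k = 1 - α`: on a
face turned towards `O` at distance about one, the condition allows curvatures down to about `-k`. A
thin ellipsoid bent along a paraboloid of curvature `k` has curvature `-k + k/4` at its inner pole;
the surplus `k/4` pays for all error terms (`lens_inequality`). -/

/-! ### Calculus along curves and the strong maximum principle. -/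

/-- Second derivative test: the second derivative is nonpositive at a local maximum. -/
theorem second_deriv_nonpos_of_isLocalMax {f f' : ℝ → ℝ} {c t : ℝ}
    (hf : ∀ᶠ s in nhds t, HasDerivAt f (f' s) s) (hf' : HasDerivAt f' c t)
    (hmax : IsLocalMax f t) : c ≤ 0 := by
  by_contra! hc
  have hev : deriv f =ᶠ[nhds t] f' := hf.mono fun s hs => hs.deriv
  have hdd : deriv (deriv f) t = c := by rw [hev.deriv_eq]; exact hf'.deriv
  -- A positive second derivative makes `t` a local minimum too, so `f` is locally constant and `c =
  -- 0`.
  have hmin : IsLocalMin f t :=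
    isLocalMin_of_deriv_deriv_pos (by rw [hdd]; exact hc) hmax.deriv_eq_zero
      hf.self_of_nhds.continuousAt
  have hconst : f =ᶠ[nhds t] fun _ => f t := by
    filter_upwards [hmax, hmin] with s h1 h2 using le_antisymm h1 h2
  have h0 : deriv f =ᶠ[nhds t] fun _ => 0 := by
    filter_upwards [hconst.eventuallyEq_nhds] with s hs
    rw [hs.deriv_eq]; simp
  rw [h0.deriv_eq] at hdd
  simp at hdd
  exact hc.ne hdd

theorem hasDerivAt_fderiv_comp_curve {φ : E → ℝ} {γ γ' : ℝ → E} {c : E} {t : ℝ}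
    (hC : ContDiffAt ℝ 2 φ (γ t)) (h1 : HasDerivAt γ (γ' t) t) (h2 : HasDerivAt γ' c t) :
    HasDerivAt (fun s => fderiv ℝ φ (γ s) (γ' s))
      (fderiv ℝ (fderiv ℝ φ) (γ t) (γ' t) (γ' t) + fderiv ℝ φ (γ t) c) t := by
  have hD : HasFDerivAt (fderiv ℝ φ) (fderiv ℝ (fderiv ℝ φ) (γ t)) (γ t) :=
    ((hC.fderiv_right (m := 1) (by norm_num)).differentiableAt (by norm_num)).hasFDerivAt
  have hD' : HasDerivAt (fun s => fderiv ℝ φ (γ s)) (fderiv ℝ (fderiv ℝ φ) (γ t) (γ' t)) t :=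
    hD.comp_hasDerivAt t h1
  exact HasDerivAt.clm_apply hD' h2

theorem lt_of_fderiv_pos_on_ball {φ : E → ℝ} {y n : E} {r : ℝ}
    (hd : ∀ z ∈ Metric.ball y r, DifferentiableAt ℝ φ z)
    (hpos : ∀ z ∈ Metric.ball y r, 0 < fderiv ℝ φ z n) {z : E} {s s' : ℝ} (hlt : s < s')
    (hs : z + s • n ∈ Metric.ball y r) (hs' : z + s' • n ∈ Metric.ball y r) :
    φ (z + s • n) < φ (z + s' • n) := by
  have hmem : ∀ t ∈ Set.Icc s s', z + t • n ∈ Metric.ball y r := by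
    intro t ht
    rw [← segment_eq_Icc hlt.le] at ht
    obtain ⟨a, b, ha, hb, hab, rfl⟩ := ht
    have := convex_ball y r hs hs' ha hb hab
    convert this using 1
    obtain rfl : b = 1 - a := by linarith
    simp only [smul_eq_mul]
    module
  have hder : ∀ t ∈ Set.Icc s s', HasDerivAt (fun t : ℝ => φ (z + t • n))
      (fderiv ℝ φ (z + t • n) n) t := by
    intro t ht
    have h1 : HasDerivAt (fun t : ℝ => z + t • n) n t := by
      simpa using ((hasDerivAt_id t).smul_const n).const_add z
    exact (hd _ (hmem t ht)).hasFDerivAt.comp_hasDerivAt t h1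
  have hm : StrictMonoOn (fun t : ℝ => φ (z + t • n)) (Set.Icc s s') := by
    refine strictMonoOn_of_deriv_pos (convex_Icc s s')
      (fun t ht => (hder t ht).continuousAt.continuousWithinAt) fun t ht => ?_
    have ht' := interior_subset ht
    rw [(hder t ht').deriv]
    exact hpos _ (hmem t ht')
  exact hm ⟨le_rfl, hlt.le⟩ ⟨hlt.le, le_rfl⟩ hlt

set_option maxHeartbeats 1000000 in
/-- Strong maximum principle for a line touching `{φ = 0}` from inside, one-sided version. -/
theorem eventually_eq_zero_of_touching {φ : E → ℝ} {y p u n : E} {r l M : ℝ} {κ : E → ℝ}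
    (hr : 0 < r) (hC : ∀ z ∈ Metric.ball y r, ContDiffAt ℝ 2 φ z)
    (hpos : ∀ z ∈ Metric.ball y r, 0 < fderiv ℝ φ z n) (hy : φ y = 0)
    (hκ0 : ∀ z ∈ Metric.ball y r, 0 ≤ κ z) (hκ : ∀ z ∈ Metric.ball y r, κ z ≤ M)
    (hcond : ∀ z ∈ Metric.ball y r, φ z = 0 → ∀ v, fderiv ℝ φ z v = 0 →
      κ z * fderiv ℝ φ z (z - p) * ‖v‖ ^ 2 ≤ fderiv ℝ (fderiv ℝ φ) z v v)
    (hyp : y - p = l • u) (hu : ∀ᶠ t : ℝ in nhds 0, φ (y + t • u) ≤ 0) :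
    ∀ᶠ t : ℝ in nhdsWithin 0 (Set.Ici 0), φ (y + t • u) = 0 := by
  have hd : ∀ z ∈ Metric.ball y r, DifferentiableAt ℝ φ z := fun z hz =>
    (hC z hz).differentiableAt (by norm_num)
  have hM : 0 ≤ M := (hκ0 y (Metric.mem_ball_self hr)).trans (hκ y (Metric.mem_ball_self hr))
  have hyu : fderiv ℝ φ y u = 0 := by
    have h1 : HasDerivAt (fun t : ℝ => y + t • u) u 0 := by
      simpa using ((hasDerivAt_id (0 : ℝ)).smul_const u).const_add y
    have h2 : HasFDerivAt φ (fderiv ℝ φ y) (y + (0 : ℝ) • u) := by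
      simpa using (hd y (Metric.mem_ball_self hr)).hasFDerivAt
    have h3 := h2.comp_hasDerivAt (0 : ℝ) h1
    have hmax : IsLocalMax (φ ∘ fun t : ℝ => y + t • u) 0 := by
      filter_upwards [hu] with t ht
      simpa [hy] using ht
    exact hmax.hasDerivAt_eq_zero h3
  obtain ⟨τ, hτ, hτu⟩ := Metric.eventually_nhds_iff.1 hu
  obtain ⟨τ', hτ', hτr⟩ : ∃ τ' > 0, τ' * ‖u‖ < r / 2 :=
    ⟨r / (4 * (‖u‖ + 1)), by positivity, by
      rw [div_mul_eq_mul_div, div_lt_iff₀ (by positivity)]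
      nlinarith [norm_nonneg u]⟩
  obtain ⟨s₀, hs₀, hs₀r⟩ : ∃ s₀ > 0, s₀ * ‖n‖ < r / 2 :=
    ⟨r / (4 * (‖n‖ + 1)), by positivity, by
      rw [div_mul_eq_mul_div, div_lt_iff₀ (by positivity)]
      nlinarith [norm_nonneg n]⟩
  -- The bound `1` gives `l + t ≤ |l| + 1` later, so that `K` does not depend on `t₁`.
  have hev : ∀ᶠ t : ℝ in nhdsWithin 0 (Set.Ici 0), t ∈ Set.Ico 0 (min τ (min τ' 1)) :=
    Ico_mem_nhdsGE (by positivity)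
  filter_upwards [hev] with t₁ ht₁
  obtain ⟨ht0, ht1⟩ := ht₁
  obtain ⟨htτ, ht1⟩ := lt_min_iff.1 ht1
  obtain ⟨htτ', htone⟩ := lt_min_iff.1 ht1
  have hφu : ∀ t ∈ Set.Icc 0 t₁, φ (y + t • u) ≤ 0 := fun t ht => hτu (by
    rw [Real.dist_eq, sub_zero, abs_of_nonneg ht.1]; exact ht.2.trans_lt htτ)
  refine le_antisymm (hφu t₁ ⟨ht0, le_rfl⟩) ?_
  by_contra! hneg
  have ht0' : 0 < t₁ := by
    rcases ht0.eq_or_lt with h | h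
    · rw [← h] at hneg; simp [hy] at hneg
    · exact h
  have hmem : ∀ t ∈ Set.Icc 0 t₁, ∀ s ∈ Set.Icc (-s₀) s₀,
      y + t • u + s • n ∈ Metric.ball y r := by
    intro t ht s hs
    rw [Metric.mem_ball, dist_eq_norm, add_assoc, add_sub_cancel_left]
    calc ‖t • u + s • n‖ ≤ ‖t • u‖ + ‖s • n‖ := norm_add_le _ _
      _ = t * ‖u‖ + |s| * ‖n‖ := by
        rw [norm_smul, norm_smul, Real.norm_of_nonneg ht.1, Real.norm_eq_abs]
      _ ≤ τ' * ‖u‖ + s₀ * ‖n‖ := by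
        gcongr
        · exact ht.2.trans htτ'.le
        · exact abs_le.2 hs
      _ < r := by linarith
  set V : ℝ := ‖u‖ + ‖n‖ with hV
  -- `K` exceeds the constant in the lower bound `hfin` for the Hessian by one; this surplus is the
  -- final contradiction.
  set K : ℝ := M * V ^ 2 * (|l| + 1) + 1 with hK
  have hK1 : 1 ≤ K := by rw [hK]; have : 0 ≤ M * V ^ 2 * (|l| + 1) := by positivity
                         linarith
  -- In order: the curve stays in the ball, its slope stays below `1` (so its velocity is bounded by
  -- `V`), and its end stays in `{φ < 0}`.
  obtain ⟨ε, hε, hε1, hε2, hε3⟩ : ∃ ε : ℝ, 0 < ε ∧ ε * (Real.exp (K * t₁) - 1) < s₀ ∧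
      ε * (K * Real.exp (K * t₁)) < 1 ∧
      φ (y + t₁ • u + (ε * (Real.exp (K * t₁) - 1)) • n) < 0 := by
    have e1 : ∀ᶠ ε : ℝ in nhds 0, ε * (Real.exp (K * t₁) - 1) < s₀ :=
      (Continuous.tendsto' (by fun_prop) 0 0 (by simp)).eventually_lt_const hs₀
    have e2 : ∀ᶠ ε : ℝ in nhds 0, ε * (K * Real.exp (K * t₁)) < 1 :=
      (Continuous.tendsto' (by fun_prop) 0 0 (by simp)).eventually_lt_const one_pos
    have e3 : ∀ᶠ ε : ℝ in nhds 0, φ (y + t₁ • u + (ε * (Real.exp (K * t₁) - 1)) • n) < 0 := by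
      have hb := hmem t₁ ⟨ht0, le_rfl⟩ 0 ⟨by linarith, hs₀.le⟩
      rw [zero_smul, add_zero] at hb
      have hc := (hd _ hb).continuousAt
      have hcont : Filter.Tendsto
          (fun ε : ℝ => y + t₁ • u + (ε * (Real.exp (K * t₁) - 1)) • n) (nhds 0)
          (nhds (y + t₁ • u)) := Continuous.tendsto' (by fun_prop) _ _ (by simp)
      exact (hc.tendsto.comp hcont).eventually_lt_const hneg
    have := ((e1.and (e2.and e3)).filter_mono (nhdsWithin_le_nhds (s := Set.Ioi 0))).and
      self_mem_nhdsWithin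
    obtain ⟨ε, h, h0⟩ := this.exists
    exact ⟨ε, h0, h⟩
  -- The barrier satisfies `w'' = K w'`: its second derivative dominates any smaller multiple of its
  -- slope.
  set w : ℝ → ℝ := fun t => ε * (Real.exp (K * t) - 1) with hw
  have hw0 : ∀ t ∈ Set.Icc 0 t₁, 0 ≤ w t := fun t ht => by
    have : 1 ≤ Real.exp (K * t) := Real.one_le_exp (mul_nonneg (by linarith) ht.1)
    exact mul_nonneg hε.le (by linarith)
  have hw1 : ∀ t ∈ Set.Icc 0 t₁, w t < s₀ := fun t ht => by
    refine lt_of_le_of_lt ?_ hε1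
    simp only [hw]
    gcongr
    exact ht.2
  set Γ : ℝ → ℝ → E := fun t s => y + t • u + (w t - s) • n with hΓ
  have hΓmem : ∀ t ∈ Set.Icc 0 t₁, ∀ s ∈ Set.Icc 0 s₀, Γ t s ∈ Metric.ball y r :=
    fun t ht s hs => hmem t ht _
      ⟨by linarith [hw0 t ht, hs.2], by linarith [hw1 t ht, hs.1]⟩
  have hΓc : Continuous fun x : ℝ × ℝ => Γ x.1 x.2 := by
    simp only [hΓ, hw]; fun_prop
  have hΓmono : ∀ t ∈ Set.Icc 0 t₁, ∀ s ∈ Set.Icc 0 s₀, ∀ s' ∈ Set.Icc 0 s₀, s < s' →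
      φ (Γ t s') < φ (Γ t s) := fun t ht s hs s' hs' h =>
    lt_of_fderiv_pos_on_ball hd hpos (by linarith) (hΓmem t ht s' hs') (hΓmem t ht s hs)
  -- the largest shift for which the curve still meets `{0 ≤ φ}`
  set B : Set (ℝ × ℝ) := {x | x ∈ Set.Icc 0 t₁ ×ˢ Set.Icc 0 s₀ ∧ 0 ≤ φ (Γ x.1 x.2)} with hB
  have hcontφ : ContinuousOn (fun x : ℝ × ℝ => φ (Γ x.1 x.2)) (Set.Icc 0 t₁ ×ˢ Set.Icc 0 s₀) := by
    intro x hx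
    exact ((hd _ (hΓmem _ hx.1 _ hx.2)).continuousAt.comp (f := fun x : ℝ × ℝ => Γ x.1 x.2)
      hΓc.continuousAt).continuousWithinAt
  have hBcpt : IsCompact B :=
    (isCompact_Icc.prod isCompact_Icc).of_isClosed_subset
      (hcontφ.preimage_isClosed_of_isClosed (isClosed_Icc.prod isClosed_Icc) isClosed_Ici)
      fun x hx => hx.1
  -- `u` is tangent at `y` and `w' 0 > 0`, so the unshifted curve leaves `y` into `{φ > 0}`.
  obtain ⟨t', ht', hφt'⟩ : ∃ t' ∈ Set.Icc 0 t₁, 0 < φ (Γ t' 0) := by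
    have hw' : HasDerivAt w (ε * K) 0 := by
      have := (((hasDerivAt_id (0 : ℝ)).const_mul K).exp.sub_const 1).const_mul ε
      simpa using this
    have h1 : HasDerivAt (fun t : ℝ => Γ t 0) (u + (ε * K) • n) 0 := by
      have := (((hasDerivAt_id (0 : ℝ)).smul_const u).const_add y).fun_add
        ((hw'.sub_const 0).smul_const n)
      simpa [hΓ] using this
    have hΓ0 : Γ 0 0 = y := by simp [hΓ, hw]
    have h2 : HasFDerivAt φ (fderiv ℝ φ y) (Γ 0 0) := by
      rw [hΓ0]; exact (hd y (Metric.mem_ball_self hr)).hasFDerivAt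
    have h3 := h2.comp_hasDerivAt (f := fun t => Γ t 0) (0 : ℝ) h1
    have h4 := h3.tendsto_slope_zero_right
    have h5 : 0 < fderiv ℝ φ y (u + (ε * K) • n) := by
      rw [map_add, hyu, zero_add, map_smul, smul_eq_mul]
      exact mul_pos (by positivity) (hpos y (Metric.mem_ball_self hr))
    have h6 : ∀ᶠ t : ℝ in nhdsWithin 0 (Set.Ioi 0), t ∈ Set.Ioo 0 t₁ := Ioo_mem_nhdsGT ht0'
    obtain ⟨t, ht, hti⟩ := ((h4.eventually_const_lt h5).and h6).exists
    refine ⟨t, ⟨hti.1.le, hti.2.le⟩, ?_⟩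
    simp only [zero_add, Function.comp, hΓ0, hy, sub_zero, smul_eq_mul] at ht
    exact pos_of_mul_pos_right ht (inv_nonneg.2 hti.1.le)
  have hzero : (0 : ℝ) ∈ Set.Icc 0 s₀ := ⟨le_rfl, hs₀.le⟩
  have hBne : B.Nonempty := ⟨(t', 0), ⟨ht', hzero⟩, hφt'.le⟩
  obtain ⟨⟨ts, ss⟩, ⟨⟨hts, hss⟩, hφs⟩, hmax⟩ :=
    hBcpt.exists_isMaxOn hBne (f := Prod.snd) continuous_snd.continuousOn
  simp only at hts hss hφs
  have hmax' : ∀ t ∈ Set.Icc 0 t₁, ∀ s ∈ Set.Icc 0 s₀, 0 ≤ φ (Γ t s) → s ≤ ss :=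
    fun t ht s hs h => hmax (a := (t, s)) ⟨⟨ht, hs⟩, h⟩
  have hss0 : 0 < ss := by
    have hc : ContinuousAt (fun s : ℝ => φ (Γ t' s)) 0 :=
      (hd _ (hΓmem t' ht' 0 hzero)).continuousAt.comp (f := fun s : ℝ => Γ t' s)
        (hΓc.comp (Continuous.prodMk_right t')).continuousAt
    have h1 : ∀ᶠ s : ℝ in nhdsWithin 0 (Set.Ioi 0), 0 < φ (Γ t' s) :=
      (hc.eventually_const_lt hφt').filter_mono nhdsWithin_le_nhds
    have h6 : ∀ᶠ t : ℝ in nhdsWithin 0 (Set.Ioi 0), t ∈ Set.Ioo 0 s₀ := Ioo_mem_nhdsGT hs₀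
    obtain ⟨s, h, hs⟩ := (h1.and h6).exists
    exact hs.1.trans_le (hmax' t' ht' s ⟨hs.1.le, hs.2.le⟩ h.le)
  -- `g` is the height of the touching point above the line
  have hg : 0 ≤ w ts - ss := by
    by_contra! hg
    have h0 := hmem ts hts 0 ⟨by linarith, hs₀.le⟩
    have := lt_of_fderiv_pos_on_ball hd hpos hg (hΓmem ts hts ss hss) h0
    rw [zero_smul, add_zero] at this
    exact absurd (hφs.trans_lt this) (not_lt.2 (hφu ts hts))
  have hsslt : ss < s₀ := by linarith [hw1 ts hts]
  have hle : ∀ t ∈ Set.Icc 0 t₁, φ (Γ t ss) ≤ 0 := by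
    intro t ht
    by_contra! hlt
    have hc : ContinuousAt (fun s : ℝ => φ (Γ t s)) ss :=
      (hd _ (hΓmem t ht ss hss)).continuousAt.comp (f := fun s : ℝ => Γ t s)
        (hΓc.comp (Continuous.prodMk_right t)).continuousAt
    have h1 : ∀ᶠ s : ℝ in nhdsWithin ss (Set.Ioi ss), 0 < φ (Γ t s) :=
      (hc.eventually_const_lt hlt).filter_mono nhdsWithin_le_nhds
    have h6 : ∀ᶠ s : ℝ in nhdsWithin ss (Set.Ioi ss), s ∈ Set.Ioo ss s₀ := Ioo_mem_nhdsGT hsslt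
    obtain ⟨s, h, hs⟩ := (h1.and h6).exists
    exact absurd (hmax' t ht s ⟨hss0.le.trans hs.1.le, hs.2.le⟩ h.le) (not_le.2 hs.1)
  have hz0 : φ (Γ ts ss) = 0 := le_antisymm (hle ts hts) hφs
  -- The last contact is interior: the shifted curve starts strictly below `y`, and ends below a
  -- point where `φ < 0`.
  have hts0 : ts ≠ 0 := by
    rintro rfl
    have := hΓmono 0 hts 0 hzero ss hss hss0
    rw [hz0] at this
    simp [hΓ, hw, hy] at this
  have hts1 : ts ≠ t₁ := by
    rintro rfl
    have := hΓmono ts hts 0 hzero ss hss hss0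
    rw [hz0] at this
    simp only [hΓ, sub_zero] at this
    exact lt_asymm this hε3
  have hio : Set.Ioo 0 t₁ ∈ nhds ts :=
    Ioo_mem_nhds (hts.1.lt_of_ne' hts0) (hts.2.lt_of_ne hts1)
  set w' : ℝ → ℝ := fun t => ε * (K * Real.exp (K * t)) with hw'
  have hKt : ∀ t : ℝ, HasDerivAt (fun t => K * t) K t := fun t => by
    simpa using (hasDerivAt_id t).const_mul K
  have hwd : ∀ t, HasDerivAt w (w' t) t := fun t =>
    (((hKt t).exp.sub_const 1).const_mul ε).congr_deriv (by simp only [hw']; ring)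
  have hwdd : HasDerivAt w' (K * w' ts) ts :=
    (((hKt ts).exp.const_mul K).const_mul ε).congr_deriv (by simp only [hw']; ring)
  have hΓd : ∀ t, HasDerivAt (fun t => Γ t ss) (u + w' t • n) t := fun t => by
    have := (((hasDerivAt_id t).smul_const u).const_add y).fun_add
      (((hwd t).sub_const ss).smul_const n)
    simpa [hΓ] using this
  have hF : ∀ᶠ t in nhds ts, HasDerivAt (fun t => φ (Γ t ss))
      (fderiv ℝ φ (Γ t ss) (u + w' t • n)) t := by
    filter_upwards [hio] with t ht
    exact (hd _ (hΓmem t ⟨ht.1.le, ht.2.le⟩ ss hss)).hasFDerivAt.comp_hasDerivAt t (hΓd t)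
  have hF2 := hasDerivAt_fderiv_comp_curve (γ := fun t => Γ t ss) (γ' := fun t => u + w' t • n)
    (hC _ (hΓmem ts hts ss hss)) (hΓd ts) ((hwdd.smul_const n).const_add u)
  have hlm : IsLocalMax (fun t => φ (Γ t ss)) ts := by
    filter_upwards [hio] with t ht
    rw [hz0]
    exact hle t ⟨ht.1.le, ht.2.le⟩
  have hsec := second_deriv_nonpos_of_isLocalMax hF hF2 hlm
  have hfst : fderiv ℝ φ (Γ ts ss) (u + w' ts • n) = 0 := hlm.hasDerivAt_eq_zero hF.self_of_nhds
  set z := Γ ts ss with hz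
  have hzb : z ∈ Metric.ball y r := hΓmem ts hts ss hss
  have hcz := hcond z hzb hz0 _ hfst
  set v := u + w' ts • n with hv
  have hw'pos : 0 < w' ts := by simp only [hw']; positivity
  have hw'1 : w' ts ≤ 1 := by
    refine le_trans ?_ hε2.le
    simp only [hw']
    gcongr
    exact hts.2
  have hvV : ‖v‖ ≤ V := by
    calc ‖v‖ ≤ ‖u‖ + ‖w' ts • n‖ := norm_add_le _ _
      _ ≤ ‖u‖ + 1 * ‖n‖ := by
        rw [norm_smul, Real.norm_of_nonneg hw'pos.le]; gcongr
      _ = V := by rw [one_mul]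
  have hN := hpos z hzb
  set N := fderiv ℝ φ z n with hNdef
  have hNu : fderiv ℝ φ z u = - (w' ts * N) := by
    rw [hv, map_add, map_smul, smul_eq_mul] at hfst
    linarith
  have hzp : z - p = (l + ts) • u + (w ts - ss) • n := by
    have : z - p = (y - p) + (ts • u + (w ts - ss) • n) := by
      simp only [hz, hΓ]; abel
    rw [this, hyp, add_smul]; abel
  -- Since `v` is tangent, `u` has `dφ`-component `-w' N`. The part of `z - p` along `n` has a
  -- nonnegative coefficient by `hg` and can be dropped.
  have hlow : -((|l| + 1) * (w' ts * N)) ≤ fderiv ℝ φ z (z - p) := by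
    rw [hzp, map_add, map_smul, map_smul, hNu, smul_eq_mul, smul_eq_mul]
    have h1 : 0 ≤ (w ts - ss) * N := mul_nonneg hg hN.le
    have h2 : l + ts ≤ |l| + 1 := by linarith [le_abs_self l, hts.2]
    have h3 : 0 < w' ts * N := mul_pos hw'pos hN
    linarith [mul_le_mul_of_nonneg_right h2 h3.le]
  have hfin : -(M * V ^ 2 * (|l| + 1) * (w' ts * N)) ≤ fderiv ℝ (fderiv ℝ φ) z v v := by
    refine le_trans ?_ hcz
    have h3 : 0 < w' ts * N := mul_pos hw'pos hN
    have hq : κ z * ‖v‖ ^ 2 ≤ M * V ^ 2 := by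
      have := hκ z hzb
      gcongr
    have hq0 : 0 ≤ κ z * ‖v‖ ^ 2 := mul_nonneg (hκ0 z hzb) (by positivity)
    calc -(M * V ^ 2 * (|l| + 1) * (w' ts * N))
        = (M * V ^ 2) * (-((|l| + 1) * (w' ts * N))) := by ring
      -- The second factor is nonpositive, so enlarging `κ z * ‖v‖ ^ 2` to `M * V ^ 2` lowers the
      -- product.
      _ ≤ (κ z * ‖v‖ ^ 2) * (-((|l| + 1) * (w' ts * N))) := by
        apply mul_le_mul_of_nonpos_right hq
        have : 0 ≤ (|l| + 1) * (w' ts * N) := by positivity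
        linarith
      _ ≤ (κ z * ‖v‖ ^ 2) * fderiv ℝ φ z (z - p) := by gcongr
      _ = _ := by ring
  rw [map_smul, smul_eq_mul, ← hNdef] at hsec
  have : 0 < w' ts * N := mul_pos hw'pos hN
  rw [hK] at hsec
  linarith

/-! ### From touching lines to star-shapedness and convexity. -/

section

theorem IsDefiningFunctionOn.nonpos_of_mem_closure {n : WithTop ℕ∞} {Ω U : Set E} {φ : E → ℝ}
    {z : E} (h : IsDefiningFunctionOn n Ω U φ) (hzU : z ∈ U) (hz : z ∈ closure Ω) : φ z ≤ 0 := by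
  obtain ⟨hU, hC, hdef⟩ := h
  by_contra! hlt
  have hnb : {z | z ∈ U ∧ 0 < φ z} ∈ nhds z :=
    (hU.eventually_mem hzU).and
      ((hC.continuousOn.continuousAt (hU.mem_nhds hzU)).eventually_const_lt hlt)
  obtain ⟨z', hz', hzΩ⟩ := mem_closure_iff_nhds.1 hz _ hnb
  exact absurd ((hdef z' hz'.1).1 hzΩ) (not_lt.2 hz'.2.le)

theorem IsDefiningFunctionOn.eq_zero_of_mem_frontier {n : WithTop ℕ∞} {Ω U : Set E} {φ : E → ℝ}
    {z : E} (h : IsDefiningFunctionOn n Ω U φ) (hΩ : IsOpen Ω) (hzU : z ∈ U)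
    (hz : z ∈ frontier Ω) : φ z = 0 := by
  rw [hΩ.frontier_eq] at hz
  exact le_antisymm (h.nonpos_of_mem_closure hzU hz.1)
    (not_lt.1 fun hlt => hz.2 ((h.2.2 z hzU).2 hlt))

variable [CompleteSpace E]

theorem IsDefiningFunctionOn.inner_outwardNormal {n : WithTop ℕ∞} {Ω U : Set E} {φ : E → ℝ} {x : E}
    (h : IsDefiningFunctionOn n Ω U φ) (hn : 1 ≤ n)
    (hΩ : IsOpen Ω) (hx : x ∈ frontier Ω) (hxU : x ∈ U) (hφ : fderiv ℝ φ x ≠ 0) (v : E) :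
    inner ℝ v (outwardNormal Ω x) = fderiv ℝ φ x v / ‖fderiv ℝ φ x‖ := by
  have hnorm : ‖gradient φ x‖ = ‖fderiv ℝ φ x‖ := by simp [gradient]
  rw [h.outwardNormal_eq hn hΩ hx hxU hφ, real_inner_smul_right, real_inner_comm, hnorm, gradient,
    InnerProductSpace.toDual_symm_apply, div_eq_inv_mul]

/-- If a line through `p` touches `∂Ω` at `y` from inside, then it stays in `∂Ω` near `y`,
provided that the second fundamental form is at least `κ ⟨z - p, ν⟩` with `κ ≥ 0` bounded. -/
theorem eventually_notMem_of_touching {Ω : Set E} (hΩ : IsOpen Ω)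
    {y : E} (hy : y ∈ frontier Ω)
    (hb : ∃ (U : Set E) (φ : E → ℝ), y ∈ U ∧ IsDefiningFunctionOn 2 Ω U φ ∧ fderiv ℝ φ y ≠ 0)
    {p u : E} {l M : ℝ} {κ : E → ℝ} (hκ0 : ∀ z, 0 ≤ κ z) (hκ : ∀ᶠ z in nhds y, κ z ≤ M)
    (hcond : ∀ z ∈ frontier Ω, ∀ v, inner ℝ v (outwardNormal Ω z) = 0 →
      κ z * inner ℝ (z - p) (outwardNormal Ω z) * ‖v‖ ^ 2 ≤ secondFundamentalForm Ω z v v)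
    (hyp : y - p = l • u) (hu : ∀ᶠ t : ℝ in nhds 0, y + t • u ∈ closure Ω) :
    ∀ᶠ t : ℝ in nhds 0, y + t • u ∉ Ω := by
  obtain ⟨U, φ, hyU, hdef, hφ⟩ := hb
  have hUo := hdef.1
  have hC : ∀ z ∈ U, ContDiffAt ℝ 2 φ z := fun z hz => hdef.2.1.contDiffAt (hUo.mem_nhds hz)
  obtain ⟨n, hn⟩ : ∃ n, 0 < fderiv ℝ φ y n := by
    obtain ⟨n, hn⟩ : ∃ n, fderiv ℝ φ y n ≠ 0 := by
      by_contra! h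
      exact hφ (ContinuousLinearMap.ext h)
    rcases lt_or_gt_of_ne hn with h | h
    · exact ⟨-n, by rw [map_neg]; linarith⟩
    · exact ⟨n, h⟩
  have hnc : ContinuousAt (fun z => fderiv ℝ φ z n) y :=
    (((hC y hyU).fderiv_right (m := 1) (by norm_num)).continuousAt).clm_apply continuousAt_const
  obtain ⟨r, hr, hball⟩ := Metric.eventually_nhds_iff_ball.1
    ((hUo.eventually_mem hyU).and ((hnc.eventually_const_lt hn).and hκ))
  have hd : ∀ z ∈ Metric.ball y r, DifferentiableAt ℝ φ z := fun z hz =>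
    (hC z (hball z hz).1).differentiableAt (by norm_num)
  have hpos := fun z hz => (hball z hz).2.1
  -- In terms of `φ` both sides of the curvature condition carry the factor `1 / ‖dφ‖`, which
  -- cancels.
  have hcond' : ∀ z ∈ Metric.ball y r, φ z = 0 → ∀ v, fderiv ℝ φ z v = 0 →
      κ z * fderiv ℝ φ z (z - p) * ‖v‖ ^ 2 ≤ fderiv ℝ (fderiv ℝ φ) z v v := by
    intro z hz hz0 v hv
    have hzU := (hball z hz).1
    have hne : fderiv ℝ φ z ≠ 0 := fun h => by
      have := hpos z hz
      rw [h] at this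
      simp at this
    have hzn : z ∉ Ω := fun h => by
      have := (hdef.2.2 z hzU).1 h
      linarith
    have hzf : z ∈ frontier Ω := by
      rw [hΩ.frontier_eq]
      refine ⟨?_, hzn⟩
      -- Moving from `z` along `-n` enters `{φ < 0}`, so a zero of `φ` in the ball is a boundary
      -- point.
      have hcont : Filter.Tendsto (fun t : ℝ => z + t • n) (nhdsWithin 0 (Set.Iio 0)) (nhds z) :=
        (Continuous.tendsto' (by fun_prop) _ _ (by simp)).mono_left nhdsWithin_le_nhds
      refine mem_closure_of_tendsto hcont ?_
      filter_upwards [hcont.eventually (Metric.isOpen_ball.mem_nhds hz), self_mem_nhdsWithin]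
        with t ht ht0
      have := lt_of_fderiv_pos_on_ball hd hpos ht0 ht (by simpa using hz)
      rw [zero_smul, add_zero, hz0] at this
      exact (hdef.2.2 _ (hball _ ht).1).2 this
    have hin := hdef.inner_outwardNormal (by norm_num) hΩ hzf hzU hne
    have h1 := hcond z hzf v (by rw [hin, hv, zero_div])
    rw [hdef.secondFundamentalForm_eq le_rfl hΩ hzf hzU hne hv hv, hin,
      le_div_iff₀ (norm_pos_iff.2 hne)] at h1
    have hN : ‖fderiv ℝ φ z‖ ≠ 0 := norm_ne_zero_iff.2 hne
    refine le_trans (le_of_eq ?_) h1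
    field_simp
  have hcontu : ∀ u : E, Filter.Tendsto (fun t : ℝ => y + t • u) (nhds 0) (nhds y) := fun u =>
    Continuous.tendsto' (by fun_prop) _ _ (by simp)
  have hu' : ∀ᶠ t : ℝ in nhds 0, φ (y + t • u) ≤ 0 := by
    filter_upwards [hu, (hcontu u).eventually (hUo.mem_nhds hyU)] with t h1 h2
    exact hdef.nonpos_of_mem_closure h2 h1
  have hneg : Filter.Tendsto (fun t : ℝ => -t) (nhds 0) (nhds 0) :=
    Continuous.tendsto' continuous_neg _ _ neg_zero
  have hy0 := hdef.eq_zero_of_mem_frontier hΩ hyU hy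
  have hright := eventually_eq_zero_of_touching hr (fun z hz => hC z (hball z hz).1) hpos hy0
    (fun z _ => hκ0 z) (fun z hz => (hball z hz).2.2) hcond' hyp hu'
  have hleft := eventually_eq_zero_of_touching (u := -u) (l := -l) hr
    (fun z hz => hC z (hball z hz).1) hpos hy0
    (fun z _ => hκ0 z) (fun z hz => (hball z hz).2.2) hcond' (by simpa using hyp)
    ((hneg.eventually hu').mono fun t ht => by simpa using ht)
  rw [eventually_nhdsWithin_iff] at hright hleft
  filter_upwards [hright, hneg.eventually hleft, (hcontu u).eventually (hUo.mem_nhds hyU)]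
    with t h1 h2 h3 h4
  have h5 := (hdef.2.2 _ h3).1 h4
  rcases le_total 0 t with h | h
  · exact h5.ne (h1 h)
  · exact h5.ne (by simpa using h2 (neg_nonneg.2 h))

/-- A connected domain with `II(v, v) ≥ κ ⟨z - p, ν⟩ |v|²` is star-shaped about its point `p`. -/
theorem IsBoundedDomain.starConvex {Ω : Set E} (hΩ : IsBoundedDomain 2 Ω) {p : E} (hp : p ∈ Ω)
    {κ : E → ℝ} (hκ0 : ∀ z, 0 ≤ κ z)
    (hκ : ∀ y ∈ frontier Ω, ∃ M, ∀ᶠ z in nhds y, κ z ≤ M)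
    (hcond : ∀ z ∈ frontier Ω, ∀ v, inner ℝ v (outwardNormal Ω z) = 0 →
      κ z * inner ℝ (z - p) (outwardNormal Ω z) * ‖v‖ ^ 2 ≤ secondFundamentalForm Ω z v v) :
    StarConvex ℝ p Ω := by
  have ho := hΩ.isOpen
  set S : Set E := {x | ∀ t ∈ Set.Icc (0 : ℝ) 1, p + t • (x - p) ∈ Ω} with hS
  have hSo : IsOpen S := by
    rw [isOpen_iff_eventually]
    intro x hx
    refine isCompact_Icc.eventually_forall_of_forall_eventually fun t ht => ?_
    have hc : Continuous fun z : E × ℝ => p + z.2 • (z.1 - p) := by fun_prop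
    exact hc.continuousAt.eventually (ho.mem_nhds (hx t ht))
  have hsub : Ω ⊆ S := by
    refine hΩ.isConnected.isPreconnected.subset_of_closure_inter_subset hSo
      ⟨p, hp, fun t _ => by simpa using hp⟩ ?_
    rintro x ⟨hxS, hx⟩
    have hcl : ∀ t ∈ Set.Icc (0 : ℝ) 1, p + t • (x - p) ∈ closure Ω := fun t ht => by
      have hc : Continuous fun x : E => p + t • (x - p) := by fun_prop
      exact map_mem_closure (f := fun x : E => p + t • (x - p)) hc hxS fun z hz => hz t ht
    have hline : Continuous fun t : ℝ => p + t • (x - p) := by fun_prop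
    -- Same scheme on the parameter interval: a limit of parameters with values in `Ω` cannot be a
    -- contact, since near a contact the line misses `Ω`.
    refine isPreconnected_Icc.subset_of_closure_inter_subset (ho.preimage hline)
      ⟨0, ⟨le_rfl, zero_le_one⟩,
        show p + (0 : ℝ) • (x - p) ∈ Ω by simpa using hp⟩ ?_
    rintro t ⟨htc, ht⟩
    by_contra htn
    replace htn : p + t • (x - p) ∉ Ω := htn
    have ht0 : t ≠ 0 := by rintro rfl; simp [hp] at htn
    have ht1 : t ≠ 1 := by rintro rfl; simp [hx] at htn
    have hf : p + t • (x - p) ∈ frontier Ω := by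
      rw [ho.frontier_eq]; exact ⟨hcl t ht, htn⟩
    obtain ⟨M, hM⟩ := hκ _ hf
    have hio : Set.Ioo 0 1 ∈ nhds t := Ioo_mem_nhds (ht.1.lt_of_ne' ht0) (ht.2.lt_of_ne ht1)
    have hadd : Filter.Tendsto (fun s : ℝ => t + s) (nhds 0) (nhds t) :=
      Continuous.tendsto' (by fun_prop) _ _ (by simp)
    have key := eventually_notMem_of_touching ho hf (hΩ.boundary _ hf) (p := p) (u := x - p)
      (l := t) hκ0 hM hcond (by simp) (by
        filter_upwards [hadd.eventually hio] with s hs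
        have := hcl (t + s) ⟨hs.1.le, hs.2.le⟩
        rwa [add_smul, ← add_assoc] at this)
    have hsub' : Filter.Tendsto (fun s : ℝ => s - t) (nhds t) (nhds 0) :=
      Continuous.tendsto' (by fun_prop) _ _ (by simp)
    obtain ⟨s, hs1, hs2⟩ := mem_closure_iff_nhds.1 htc _ (hsub'.eventually key)
    refine hs1 ?_
    have h2 : p + s • (x - p) ∈ Ω := hs2
    convert h2 using 1
    module
  rw [starConvex_iff_forall_pos hp]
  intro x hx a b ha hb hab
  have := hsub hx b ⟨hb.le, by linarith⟩
  convert this using 1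
  obtain rfl : a = 1 - b := by linarith
  module

/-- Otherwise `p - x` makes an acute angle with `ν`, so the segment from `x` to `p` starts outside
the closure, which star-shapedness forbids. -/
theorem IsBoundedDomain.inner_outwardNormal_nonneg {Ω : Set E} {n : WithTop ℕ∞} (hn : 1 ≤ n)
    (hΩ : IsBoundedDomain n Ω) {p : E} (hs : StarConvex ℝ p Ω) {x : E} (hx : x ∈ frontier Ω) :
    0 ≤ inner ℝ (x - p) (outwardNormal Ω x) := by
  obtain ⟨U, φ, hxU, hdef, hφ⟩ := hΩ.boundary x hx
  have hν := hdef.isOutwardUnitNormal hn hΩ.isOpen hx hxU hφ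
  rw [hν.outwardNormal_eq]
  by_contra! hlt
  have hcl : ∀ t ∈ Set.Icc (0 : ℝ) 1, x + t • (p - x) ∈ closure Ω := fun t ht => by
    have hc : Continuous fun x : E => x + t • (p - x) := by fun_prop
    refine map_mem_closure (f := fun x : E => x + t • (p - x)) hc hx.1 fun z hz => ?_
    have := hs hz ht.1 (sub_nonneg.2 ht.2) (by ring)
    convert this using 1
    module
  have h1 := hν.2.2 (p - x) (by rw [← neg_sub, inner_neg_left]; linarith)
  have h2 : ∀ᶠ t : ℝ in nhdsWithin 0 (Set.Ioi 0), t ∈ Set.Ioo 0 1 := Ioo_mem_nhdsGT one_pos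
  obtain ⟨t, ht, hti⟩ := (h1.and h2).exists
  exact ht (hcl t ⟨hti.1.le, hti.2.le⟩)

theorem IsBoundedDomain.convex_of_satisfiesCondition {Ω : Set E} (hΩ : IsBoundedDomain 2 Ω)
    {α : ℝ} (hα : α ≤ 1) (hc : SatisfiesCondition α Ω) (h0 : (0 : E) ∈ Ω) : Convex ℝ Ω := by
  have hα' : 0 ≤ 1 - α := by linarith
  have hstar : StarConvex ℝ 0 Ω := by
    refine hΩ.starConvex (κ := fun z => (1 - α) / ‖z‖ ^ 2) h0 (fun z => by positivity)
      (fun y hy => ?_) fun z hz v hv => ?_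
    · have hy0 : y ≠ 0 := by
        rintro rfl
        rw [hΩ.isOpen.frontier_eq] at hy
        exact hy.2 h0
      have : ContinuousAt (fun z : E => (1 - α) / ‖z‖ ^ 2) y :=
        continuousAt_const.div (by fun_prop) (by simpa using hy0)
      exact ⟨_, (this.eventually_lt_const (lt_add_one _)).mono fun z hz => hz.le⟩
    · refine le_trans (le_of_eq ?_) (hc z hz v hv)
      rw [sub_zero]; ring
  rw [convex_iff_forall_pos]
  intro p hp
  rw [← starConvex_iff_forall_pos hp]
  -- Star-shapedness about `O` makes the right-hand side of the condition nonnegative; hence `II ≥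
  -- 0`, and every `p ∈ Ω` is admissible.
  refine hΩ.starConvex (κ := 0) hp (fun _ => le_rfl)
    (fun y _ => ⟨0, Filter.Eventually.of_forall fun _ => le_rfl⟩) fun z hz v hv => ?_
  refine le_trans ?_ (hc z hz v hv)
  have := hΩ.inner_outwardNormal_nonneg (by norm_num) hstar hz
  rw [sub_zero] at this
  simp only [Pi.zero_apply, zero_mul]
  positivity

end

/-! ### Domains with a global defining function. -/

/-- A connected bounded sublevel set of a smooth function with regular zero level. -/
theorem isBoundedDomain_sublevel {n : WithTop ℕ∞} {φ : E → ℝ} (hφ : ContDiff ℝ n φ)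
    (hreg : ∀ x, φ x = 0 → fderiv ℝ φ x ≠ 0) (hconn : IsConnected {x | φ x < 0})
    (hbdd : Bornology.IsBounded {x | φ x < 0}) : IsBoundedDomain n {x | φ x < 0} where
  isOpen := isOpen_lt hφ.continuous continuous_const
  isConnected := hconn
  isBounded := hbdd
  boundary := fun x hx => ⟨Set.univ, φ, Set.mem_univ x,
    ⟨isOpen_univ, hφ.contDiffOn, fun _ _ => Iff.rfl⟩,
    hreg x (frontier_lt_subset_eq hφ.continuous continuous_const hx)⟩

theorem satisfiesCondition_sublevel [CompleteSpace E] {φ : E → ℝ} (hφ : ContDiff ℝ 2 φ) {α : ℝ}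
    (hreg : ∀ x, φ x = 0 → fderiv ℝ φ x ≠ 0)
    (hcond : ∀ x, φ x = 0 → ∀ v, fderiv ℝ φ x v = 0 →
      (1 - α) * (fderiv ℝ φ x x / ‖x‖ ^ 2) * ‖v‖ ^ 2 ≤ fderiv ℝ (fderiv ℝ φ) x v v) :
    SatisfiesCondition α {x | φ x < 0} := by
  intro x hx v hv
  have hx0 : φ x = 0 := frontier_lt_subset_eq hφ.continuous continuous_const hx
  have ho : IsOpen {x | φ x < 0} := isOpen_lt hφ.continuous continuous_const
  have hdef : IsDefiningFunctionOn 2 {x | φ x < 0} Set.univ φ :=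
    ⟨isOpen_univ, hφ.contDiffOn, fun _ _ => Iff.rfl⟩
  have hne := hreg x hx0
  have hN : ‖fderiv ℝ φ x‖ ≠ 0 := norm_ne_zero_iff.2 hne
  have hin := hdef.inner_outwardNormal (by norm_num) ho hx (Set.mem_univ x) hne
  rw [hin, div_eq_zero_iff, or_iff_left hN] at hv
  rw [hdef.secondFundamentalForm_eq le_rfl ho hx (Set.mem_univ x) hne hv hv, hin,
    le_div_iff₀ (norm_pos_iff.2 hne)]
  refine le_trans (le_of_eq ?_) (hcond x hx0 v hv)
  field_simp

/-! Derivatives along lines. -/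

theorem fderiv_apply_eq_of_hasDerivAt_line {φ : E → ℝ} {x v : E} {c : ℝ}
    (hφ : DifferentiableAt ℝ φ x)
    (h : HasDerivAt (fun t : ℝ => φ (x + t • v)) c 0) : fderiv ℝ φ x v = c := by
  have h1 : HasDerivAt (fun t : ℝ => x + t • v) v 0 := by
    simpa using ((hasDerivAt_id (0 : ℝ)).smul_const v).const_add x
  have h2 : HasFDerivAt φ (fderiv ℝ φ x) (x + (0 : ℝ) • v) := by
    simpa using hφ.hasFDerivAt
  exact (h2.comp_hasDerivAt (0 : ℝ) h1).unique h

theorem fderiv_fderiv_apply_eq_of_hasDerivAt_line {φ : E → ℝ} {x v : E} {c : ℝ}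
    (hφ : ContDiff ℝ 2 φ)
    (h : HasDerivAt (fun t : ℝ => fderiv ℝ φ (x + t • v) v) c 0) :
    fderiv ℝ (fderiv ℝ φ) x v v = c := by
  have h1 : HasDerivAt (fun t : ℝ => x + t • v) v 0 := by
    simpa using ((hasDerivAt_id (0 : ℝ)).smul_const v).const_add x
  have h2 := hasDerivAt_fderiv_comp_curve (γ := fun t : ℝ => x + t • v) (γ' := fun _ => v)
    hφ.contDiffAt h1 (hasDerivAt_const (0 : ℝ) v)
  simpa using h2.unique h

/-- The functions below restrict to polynomials of degree at most four on lines, so their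
derivatives are read off as linear coefficients. -/
theorem hasDerivAt_poly4 (b₀ b₁ b₂ b₃ b₄ : ℝ) :
    HasDerivAt (fun t : ℝ => b₀ + b₁ * t + b₂ * t ^ 2 + b₃ * t ^ 3 + b₄ * t ^ 4) b₁ 0 := by
  have h := ((((hasDerivAt_const (0 : ℝ) b₀).fun_add ((hasDerivAt_id' (0 : ℝ)).const_mul b₁)).fun_add
    ((hasDerivAt_pow 2 (0 : ℝ)).const_mul b₂)).fun_add ((hasDerivAt_pow 3 (0 : ℝ)).const_mul b₃)).fun_add
    ((hasDerivAt_pow 4 (0 : ℝ)).const_mul b₄)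
  exact h.congr_deriv (by simp)

/-! The ball. -/

noncomputable def ballFunction {E : Type*} [NormedAddCommGroup E] (c : E) (x : E) : ℝ := ‖x - c‖ ^ 2 - 1

theorem ballFunction_contDiff {n : WithTop ℕ∞} (c : E) : ContDiff ℝ n (ballFunction c) :=
  ((contDiff_id.sub contDiff_const).norm_sq ℝ).sub contDiff_const

theorem fderiv_ballFunction (c x v : E) :
    fderiv ℝ (ballFunction c) x v = 2 * inner ℝ (x - c) v := by
  refine fderiv_apply_eq_of_hasDerivAt_line
    ((ballFunction_contDiff (n := 1) c).differentiable (by norm_num) x)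
    ((hasDerivAt_poly4 (‖x - c‖ ^ 2 - 1) _ (‖v‖ ^ 2) 0 0).congr_of_eventuallyEq
      (Filter.Eventually.of_forall fun t => ?_))
  have : x + t • v - c = (x - c) + t • v := by abel
  simp only [ballFunction]
  rw [this, norm_add_sq_real, real_inner_smul_right, norm_smul, mul_pow, Real.norm_eq_abs, sq_abs]
  ring

theorem fderiv_fderiv_ballFunction (c x v : E) :
    fderiv ℝ (fderiv ℝ (ballFunction c)) x v v = 2 * ‖v‖ ^ 2 := by
  refine fderiv_fderiv_apply_eq_of_hasDerivAt_line (ballFunction_contDiff c)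
    ((hasDerivAt_poly4 (2 * inner ℝ (x - c) v) _ 0 0 0).congr_of_eventuallyEq
      (Filter.Eventually.of_forall fun t => ?_))
  have : x + t • v - c = (x - c) + t • v := by abel
  simp only
  rw [fderiv_ballFunction, this, inner_add_left, real_inner_smul_left, real_inner_self_eq_norm_sq]
  ring

theorem ballFunction_sublevel {E : Type*} [NormedAddCommGroup E] (c : E) :
    {x | ballFunction c x < 0} = Metric.ball c 1 := by
  ext x
  rw [Set.mem_ofPred_eq, Metric.mem_ball, dist_eq_norm, ballFunction, sub_neg,
    sq_lt_one_iff₀ (norm_nonneg _)]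

/-- The unit ball about a point at distance `3` has `II = 1`, while `x · ν / |x|² ≤ 1 / |x| ≤ 1 / 2`
on its boundary. -/
theorem exists_convex_domain [CompleteSpace E] {a : E} (ha : ‖a‖ = 1) {α : ℝ} (hα0 : 0 ≤ α)
    (hα1 : α ≤ 1) : ∃ Ω : Set E, IsBoundedDomain ∞ Ω ∧ SatisfiesCondition α Ω ∧
      0 ∉ closure Ω ∧ Convex ℝ Ω := by
  set c : E := (3 : ℝ) • a with hc
  have hcn : ‖c‖ = 3 := by rw [hc, norm_smul, ha]; norm_num
  have hnorm : ∀ x, ballFunction c x = 0 → ‖x - c‖ = 1 := fun x hx => by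
    rw [ballFunction, sub_eq_zero] at hx
    exact (pow_eq_one_iff_of_nonneg (norm_nonneg _) two_ne_zero).1 hx
  have hreg : ∀ x, ballFunction c x = 0 → fderiv ℝ (ballFunction c) x ≠ 0 := fun x hx h => by
    have h1 := fderiv_ballFunction c x (x - c)
    rw [h, real_inner_self_eq_norm_sq, hnorm x hx] at h1
    norm_num at h1
  refine ⟨{x | ballFunction c x < 0}, isBoundedDomain_sublevel (ballFunction_contDiff c) hreg ?_ ?_,
    satisfiesCondition_sublevel (ballFunction_contDiff c) hreg ?_, ?_, ?_⟩
  · rw [ballFunction_sublevel]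
    exact ⟨⟨c, Metric.mem_ball_self one_pos⟩, (convex_ball c 1).isPreconnected⟩
  · rw [ballFunction_sublevel]
    exact Metric.isBounded_ball
  · intro x hx v _
    rw [fderiv_ballFunction, fderiv_fderiv_ballFunction]
    refine mul_le_mul_of_nonneg_right ?_ (by positivity)
    have hx1 := hnorm x hx
    have hx2 : 2 ≤ ‖x‖ := by
      have : ‖c‖ ≤ ‖x‖ + ‖x - c‖ := by
        have := norm_sub_le x (x - c)
        rwa [sub_sub_cancel] at this
      linarith
    have hin : inner ℝ (x - c) x ≤ ‖x‖ := by
      simpa [hx1] using real_inner_le_norm (x - c) x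
    have hq : 2 * inner ℝ (x - c) x / ‖x‖ ^ 2 ≤ 2 := by
      rw [div_le_iff₀ (by positivity)]
      nlinarith
    nlinarith
  · rw [ballFunction_sublevel]
    intro h
    have := Metric.closure_ball_subset_closedBall h
    rw [Metric.mem_closedBall, dist_eq_norm, zero_sub, norm_neg, hcn] at this
    norm_num at this
  · rw [ballFunction_sublevel]
    exact convex_ball c 1

/-! The bent lens `u² + (k/32)² |y|² < (k/256)²` with `y` the part of `x` orthogonal to `a` and
`u = ⟨x, a⟩ - 1 + k |y|² / 2`. -/

noncomputable def lensHeight (a : E) (k : ℝ) (x : E) : ℝ :=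
  inner ℝ a x - 1 + k / 2 * (‖x‖ ^ 2 - inner ℝ a x ^ 2)

/-- In the coordinates `(y, u)` this is an ellipsoid with semi-axes `1/8` and `k/256`. At its poles
it contributes curvature `(k/32)² / (k/256) = k/4`, less than the bending `k`. -/
noncomputable def lensFunction (a : E) (k : ℝ) (x : E) : ℝ :=
  lensHeight a k x ^ 2 + (k / 32) ^ 2 * (‖x‖ ^ 2 - inner ℝ a x ^ 2) - (k / 256) ^ 2

theorem lensFunction_contDiff {n : WithTop ℕ∞} (a : E) (k : ℝ) :
    ContDiff ℝ n (lensFunction a k) := by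
  have h1 : ContDiff ℝ n fun x : E => inner ℝ a x := contDiff_const.inner ℝ contDiff_id
  have h2 : ContDiff ℝ n fun x : E => ‖x‖ ^ 2 := contDiff_norm_sq ℝ
  have h3 : ContDiff ℝ n (lensHeight a k) :=
    (h1.sub contDiff_const).add (contDiff_const.mul (h2.sub (h1.pow 2)))
  exact ((h3.pow 2).add (contDiff_const.mul (h2.sub (h1.pow 2)))).sub contDiff_const

theorem fderiv_lensFunction (a : E) (k : ℝ) (x v : E) :
    fderiv ℝ (lensFunction a k) x v =
      2 * lensHeight a k x * (inner ℝ a v + k * (inner ℝ x v - inner ℝ a x * inner ℝ a v))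
      + 2 * (k / 32) ^ 2 * (inner ℝ x v - inner ℝ a x * inner ℝ a v) := by
  refine fderiv_apply_eq_of_hasDerivAt_line
    ((lensFunction_contDiff (n := 1) a k).differentiable (by norm_num) x) ?_
  set A := lensHeight a k x with hA
  set B := inner ℝ a v + k * (inner ℝ x v - inner ℝ a x * inner ℝ a v) with hB
  set P := ‖v‖ ^ 2 - inner ℝ a v ^ 2 with hP
  refine (hasDerivAt_poly4 (lensFunction a k x) _ (B ^ 2 + A * k * P + (k / 32) ^ 2 * P)
      (B * k * P) ((k / 2 * P) ^ 2)).congr_of_eventuallyEq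
      (Filter.Eventually.of_forall fun t => ?_)
  have h1 : lensHeight a k (x + t • v) = A + B * t + k / 2 * P * t ^ 2 := by
    simp only [hA, hB, hP, lensHeight]
    rw [norm_add_sq_real, inner_add_right, real_inner_smul_right, real_inner_smul_right, norm_smul,
      mul_pow, Real.norm_eq_abs, sq_abs]
    ring
  simp only [lensFunction]
  rw [h1, norm_add_sq_real, inner_add_right, real_inner_smul_right, real_inner_smul_right,
    norm_smul, mul_pow, Real.norm_eq_abs, sq_abs, ← hA]
  simp only [hP]
  ring

theorem fderiv_fderiv_lensFunction (a : E) (k : ℝ) (x v : E) :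
    fderiv ℝ (fderiv ℝ (lensFunction a k)) x v v =
      2 * (inner ℝ a v + k * (inner ℝ x v - inner ℝ a x * inner ℝ a v)) ^ 2
      + 2 * (lensHeight a k x * k + (k / 32) ^ 2) * (‖v‖ ^ 2 - inner ℝ a v ^ 2) := by
  refine fderiv_fderiv_apply_eq_of_hasDerivAt_line (lensFunction_contDiff a k) ?_
  set A := lensHeight a k x with hA
  set B := inner ℝ a v + k * (inner ℝ x v - inner ℝ a x * inner ℝ a v) with hB
  set P := ‖v‖ ^ 2 - inner ℝ a v ^ 2 with hP
  refine (hasDerivAt_poly4 (fderiv ℝ (lensFunction a k) x v) _ (3 * (k * P * B))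
      (2 * (k / 2 * P) * (k * P)) 0).congr_of_eventuallyEq
      (Filter.Eventually.of_forall fun t => ?_)
  have h1 : lensHeight a k (x + t • v) = A + B * t + k / 2 * P * t ^ 2 := by
    simp only [hA, hB, hP, lensHeight]
    rw [norm_add_sq_real, inner_add_right, real_inner_smul_right, real_inner_smul_right, norm_smul,
      mul_pow, Real.norm_eq_abs, sq_abs]
    ring
  have h2 : inner ℝ (x + t • v) v - inner ℝ a (x + t • v) * inner ℝ a v =
      (inner ℝ x v - inner ℝ a x * inner ℝ a v) + t * P := by
    rw [inner_add_left, inner_add_right, real_inner_smul_left, real_inner_smul_right,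
      real_inner_self_eq_norm_sq]
    ring
  simp only
  rw [fderiv_lensFunction, fderiv_lensFunction, h1, h2, ← hA]
  simp only [hB]
  ring

/-- The scalar inequality behind the curvature condition for the lens: `u` is the height,
`Y = |y|²`, `h = ⟨x, a⟩`, and `P`, `vh`, `m` stand for `|v_y|²`, `v_h`, `⟨y, v_y⟩`. -/
theorem lens_inequality {k u Y h P vh m : ℝ} (hk0 : 0 < k) (hk1 : k ≤ 1)
    (hh : h = 1 + u - k / 2 * Y) (hY : 0 ≤ Y) (hP : 0 ≤ P) (hm : m ^ 2 ≤ Y * P)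
    (h0 : u ^ 2 + (k / 32) ^ 2 * Y = (k / 256) ^ 2) :
    k * ((u * (k * Y + h) + (k / 32) ^ 2 * Y) / (Y + h ^ 2)) * (P + vh ^ 2) ≤
      (vh + k * m) ^ 2 + (u * k + (k / 32) ^ 2) * P := by
  have hYle : Y ≤ 1 / 64 := by
    -- `1/64` is the square of the semi-axis `(k/256) / (k/32) = 1/8`.
    have : (k / 32) ^ 2 * Y ≤ (k / 32) ^ 2 * (1 / 64) := by nlinarith [sq_nonneg u]
    exact le_of_mul_le_mul_left this (by positivity)
  have hu : |u| ≤ k / 256 := by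
    refine abs_le_of_sq_le_sq ?_ (by positivity)
    nlinarith [mul_nonneg (sq_nonneg (k / 32)) hY]
  obtain ⟨hu1, hu2⟩ := abs_le.1 hu
  have hkY : k * Y ≤ 1 / 64 := by nlinarith
  have hkY0 : 0 ≤ k * Y := by positivity
  have hh1 : 63 / 64 ≤ h := by rw [hh]; linarith
  have hden : 15 / 16 ≤ Y + h ^ 2 := by nlinarith
  set D := Y + h ^ 2 with hD
  set θ := (u * (k * Y + h) + (k / 32) ^ 2 * Y) / D with hθ
  have hDpos : 0 < D := by linarith
  -- the error `e = θ - u`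
  have hnum : |u * (k * Y + h) + (k / 32) ^ 2 * Y - u * D| ≤ k / 5000 := by
    -- Uses `h - h² = h (1 - h)` with `1 - h = k Y / 2 - u`, which is small.
    have e1 : u * (k * Y + h) + (k / 32) ^ 2 * Y - u * D =
        u * (k * Y - Y + h * (k / 2 * Y - u)) + (k / 32) ^ 2 * Y := by
      rw [hD, hh]; ring
    have h1 : |h * (k / 2 * Y - u)| ≤ 1 / 64 * (1 + 1 / 64) := by
      rw [abs_mul, mul_comm]
      have : |k / 2 * Y - u| ≤ 1 / 64 := by rw [abs_le]; constructor <;> linarith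
      have : |h| ≤ 1 + 1 / 64 := by rw [abs_le, hh]; constructor <;> linarith
      gcongr
    have h2 : |k * Y - Y + h * (k / 2 * Y - u)| ≤ 1 / 30 := by
      have h3 := abs_le.1 h1
      rw [abs_le]; constructor <;> linarith [h3.1, h3.2]
    have h3 : |u * (k * Y - Y + h * (k / 2 * Y - u))| ≤ k / 256 * (1 / 30) := by
      rw [abs_mul]; gcongr
    have h4 : (k / 32) ^ 2 * Y ≤ k / 65536 := by
      nlinarith [mul_nonneg hk0.le hk0.le]
    have h5 : 0 ≤ (k / 32) ^ 2 * Y := by positivity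
    rw [e1, abs_le]
    have h6 := abs_le.1 h3
    constructor <;> linarith [h6.1, h6.2]
  have he : |θ - u| ≤ k / 4500 := by
    have : θ - u = (u * (k * Y + h) + (k / 32) ^ 2 * Y - u * D) / D := by
      rw [hθ]; field_simp
    rw [this, abs_div, abs_of_pos hDpos, div_le_iff₀ hDpos]
    nlinarith
  have he' := (abs_le.1 he).2
  have hθ1 : θ ≤ k / 64 := by linarith
  have hvh : vh ^ 2 ≤ 2 * (vh + k * m) ^ 2 + k ^ 2 / 32 * P := by
    have h1 : (k * m) ^ 2 ≤ k ^ 2 * (1 / 64 * P) := by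
      rw [mul_pow]
      exact mul_le_mul_of_nonneg_left (hm.trans (by gcongr)) (by positivity)
    nlinarith [sq_nonneg (vh + 2 * (k * m))]
  set b := vh + k * m with hb
  have s1 : k * θ * P ≤ k * (u + k / 4500) * P := by gcongr; linarith
  have s2 : k * θ * vh ^ 2 ≤ k * (k / 64) * (2 * b ^ 2 + k ^ 2 / 32 * P) := by
    calc k * θ * vh ^ 2 ≤ k * (k / 64) * vh ^ 2 := by gcongr
      _ ≤ _ := by gcongr
  have hk2 : k ^ 2 ≤ 1 := by nlinarith
  have s3 : k ^ 2 * b ^ 2 ≤ b ^ 2 := mul_le_of_le_one_left (sq_nonneg b) hk2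
  have s4 : k ^ 2 * (k ^ 2 * P) ≤ k ^ 2 * P := mul_le_of_le_one_left (by positivity) hk2
  have s5 : 0 ≤ k ^ 2 * P := by positivity
  -- The coefficients of `k² P` fit since `1/4500 + 1/2048 < 1/1024`; the `b²` term costs only
  -- `1/32` of the available `b²`.
  nlinarith [sq_nonneg b]

theorem inner_sub_smul_sub_smul {a : E} (ha : ‖a‖ = 1) (x v : E) :
    inner ℝ (x - inner ℝ a x • a) (v - inner ℝ a v • a) =
      inner ℝ x v - inner ℝ a x * inner ℝ a v := by
  simp only [inner_sub_left, inner_sub_right, real_inner_smul_left, real_inner_smul_right,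
    real_inner_self_eq_norm_sq, ha, real_inner_comm x a]
  ring

theorem norm_sub_smul_sq {a : E} (ha : ‖a‖ = 1) (x : E) :
    ‖x - inner ℝ a x • a‖ ^ 2 = ‖x‖ ^ 2 - inner ℝ a x ^ 2 := by
  rw [← real_inner_self_eq_norm_sq, inner_sub_smul_sub_smul ha, real_inner_self_eq_norm_sq, sq, sq]

theorem lens_inner_sq_le {a : E} (ha : ‖a‖ = 1) (x v : E) :
    (inner ℝ x v - inner ℝ a x * inner ℝ a v) ^ 2 ≤
      (‖x‖ ^ 2 - inner ℝ a x ^ 2) * (‖v‖ ^ 2 - inner ℝ a v ^ 2) := by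
  rw [← inner_sub_smul_sub_smul ha, ← norm_sub_smul_sq ha, ← norm_sub_smul_sq ha, ← mul_pow]
  exact sq_le_sq' (neg_le_of_abs_le (abs_real_inner_le_norm _ _)) (real_inner_le_norm _ _)

/-- A parametrization of the lens by the unit ball. -/
noncomputable def lensMap (a : E) (k : ℝ) (w : E) : E :=
  (1 / 8 : ℝ) • (w - inner ℝ a w • a) +
    (1 + k / 256 * inner ℝ a w - k / 128 * (‖w‖ ^ 2 - inner ℝ a w ^ 2)) • a

theorem inner_smul_sub_add_smul {a : E} (ha : ‖a‖ = 1) (w : E) (c s : ℝ) :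
    inner ℝ a (c • (w - inner ℝ a w • a) + s • a) = s := by
  simp only [inner_sub_right, inner_add_right, real_inner_smul_right,
    real_inner_self_eq_norm_sq, ha]
  ring

theorem norm_smul_sub_add_smul_sq {a : E} (ha : ‖a‖ = 1) (w : E) (c s : ℝ) :
    ‖c • (w - inner ℝ a w • a) + s • a‖ ^ 2 - s ^ 2 = c ^ 2 * (‖w‖ ^ 2 - inner ℝ a w ^ 2) := by
  rw [← norm_sub_smul_sq ha w]
  have h := norm_sub_smul_sq ha (c • (w - inner ℝ a w • a) + s • a)
  rw [inner_smul_sub_add_smul ha, add_sub_cancel_right] at h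
  rw [← h, norm_smul, mul_pow, Real.norm_eq_abs, sq_abs]

/-- `lensMap` scales by the semi-axes and then bends, so that `u = k/256 * ⟨w, a⟩`; the lens is thus
an image of the unit ball and connected. -/
theorem lensFunction_lensMap {a : E} (ha : ‖a‖ = 1) (k : ℝ) (w : E) :
    lensFunction a k (lensMap a k w) = (k / 256) ^ 2 * (‖w‖ ^ 2 - 1) := by
  simp only [lensFunction, lensHeight, lensMap, inner_smul_sub_add_smul ha,
    norm_smul_sub_add_smul_sq ha]
  ring

theorem lensMap_surjective {a : E} (ha : ‖a‖ = 1) {k : ℝ} (hk : k ≠ 0) :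
    Function.Surjective (lensMap a k) := by
  intro x
  refine ⟨(8 : ℝ) • (x - inner ℝ a x • a) + (256 / k * lensHeight a k x) • a, ?_⟩
  simp only [lensMap, inner_smul_sub_add_smul ha, norm_smul_sub_add_smul_sq ha]
  have h : 1 + k / 256 * (256 / k * lensHeight a k x) -
      k / 128 * (8 ^ 2 * (‖x‖ ^ 2 - inner ℝ a x ^ 2)) = inner ℝ a x := by
    simp only [lensHeight]
    field_simp
    ring
  rw [h]
  module

theorem lensFunction_sublevel {a : E} (ha : ‖a‖ = 1) {k : ℝ} (hk : k ≠ 0) :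
    {x | lensFunction a k x < 0} = lensMap a k '' Metric.ball 0 1 := by
  have hk2 : 0 < (k / 256) ^ 2 := by positivity
  have key : ∀ w, lensFunction a k (lensMap a k w) < 0 ↔ w ∈ Metric.ball (0 : E) 1 := fun w => by
    rw [lensFunction_lensMap ha, mem_ball_zero_iff, ← smul_eq_mul, smul_neg_iff_of_pos_left hk2, sub_neg,
      sq_lt_one_iff₀ (norm_nonneg _)]
  ext x
  obtain ⟨w, rfl⟩ := lensMap_surjective ha hk x
  refine ⟨fun h => ⟨w, (key w).1 h, rfl⟩, ?_⟩
  rintro ⟨w', hw', h⟩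
  rw [← h]
  exact (key w').2 hw'

theorem isConnected_lens {a : E} (ha : ‖a‖ = 1) {k : ℝ} (hk : k ≠ 0) :
    IsConnected {x | lensFunction a k x < 0} := by
  rw [lensFunction_sublevel ha hk]
  have hc : Continuous (lensMap a k) := by unfold lensMap; fun_prop
  have hb : IsConnected (Metric.ball (0 : E) 1) :=
    ⟨⟨0, Metric.mem_ball_self one_pos⟩, (convex_ball 0 1).isPreconnected⟩
  exact hb.image _ hc.continuousOn

theorem isBounded_lens {a : E} (ha : ‖a‖ = 1) {k : ℝ} (hk0 : 0 < k) (hk1 : k ≤ 1) :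
    Bornology.IsBounded {x | lensFunction a k x < 0} := by
  refine (Metric.isBounded_closedBall (x := (0 : E)) (r := 3)).subset fun x hx => ?_
  rw [mem_closedBall_zero_iff]
  replace hx : lensFunction a k x < 0 := hx
  rw [lensFunction] at hx
  set u := lensHeight a k x with hu
  have hY0 : 0 ≤ ‖x‖ ^ 2 - inner ℝ a x ^ 2 := by
    rw [← norm_sub_smul_sq ha]; positivity
  set h : ℝ := inner ℝ a x with hh
  set Y := ‖x‖ ^ 2 - h ^ 2 with hY
  have hYle : Y ≤ 1 := by
    have : (k / 32) ^ 2 * Y ≤ (k / 32) ^ 2 * 1 := by nlinarith [sq_nonneg u, sq_nonneg k]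
    exact le_of_mul_le_mul_left this (by positivity)
  have hule : |u| ≤ 1 := by
    refine abs_le_of_sq_le_sq ?_ zero_le_one
    nlinarith [mul_nonneg (sq_nonneg (k / 32)) hY0]
  have hhu : h = 1 + u - k / 2 * Y := by simp only [hu, lensHeight, hY, hh]; ring
  have hkY : k * Y ≤ 1 := by nlinarith
  have hkY0 : 0 ≤ k * Y := by positivity
  obtain ⟨h1, h2⟩ := abs_le.1 hule
  have hh2 : |h| ≤ 2 := by rw [abs_le, hhu]; constructor <;> linarith
  have : h ^ 2 ≤ 2 ^ 2 := sq_le_sq' (abs_le.1 hh2).1 (abs_le.1 hh2).2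
  refine abs_le_of_sq_le_sq' ?_ (by norm_num) |>.2
  have : ‖x‖ ^ 2 = Y + h ^ 2 := by rw [hY]; ring
  linarith

theorem fderiv_lensFunction_ne_zero {a : E} (ha : ‖a‖ = 1) {k : ℝ} (hk : k ≠ 0) {x : E}
    (hx : lensFunction a k x = 0) : fderiv ℝ (lensFunction a k) x ≠ 0 := by
  intro h
  -- At a critical point, direction `a` forces `u = 0`; direction `x` then forces `y = 0`, where the
  -- function is negative.
  have h1 := fderiv_lensFunction a k x a
  rw [h, real_inner_self_eq_norm_sq, ha, real_inner_comm] at h1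
  have hu : lensHeight a k x = 0 := by
    rw [zero_apply] at h1; linarith
  have h2 := fderiv_lensFunction a k x x
  rw [h, real_inner_self_eq_norm_sq, hu, zero_apply] at h2
  rw [lensFunction, hu] at hx
  have : 0 < (k / 256) ^ 2 := by positivity
  nlinarith

theorem satisfiesCondition_lens [CompleteSpace E] {a : E} (ha : ‖a‖ = 1) {α : ℝ} (hα0 : 0 ≤ α)
    (hα1 : α < 1) : SatisfiesCondition α {x | lensFunction a (1 - α) x < 0} := by
  have hk0 : 0 < 1 - α := by linarith
  refine satisfiesCondition_sublevel (lensFunction_contDiff a _)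
    (fun x hx => fderiv_lensFunction_ne_zero ha hk0.ne' hx) fun x hx v _ => ?_
  have hY : 0 ≤ ‖x‖ ^ 2 - inner ℝ a x ^ 2 := by
    rw [← norm_sub_smul_sq ha]; positivity
  have hP : 0 ≤ ‖v‖ ^ 2 - inner ℝ a v ^ 2 := by
    rw [← norm_sub_smul_sq ha]; positivity
  have key := lens_inequality (u := lensHeight a (1 - α) x) (h := inner ℝ a x)
    (vh := inner ℝ a v) hk0 (by linarith)
    (by simp only [lensHeight]; ring) hY hP (lens_inner_sq_le ha x v) (sub_eq_zero.1 hx)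
  rw [sub_add_cancel, sub_add_cancel] at key
  rw [fderiv_lensFunction, fderiv_fderiv_lensFunction, real_inner_self_eq_norm_sq]
  calc _ = 2 * ((1 - α) * ((lensHeight a (1 - α) x *
        ((1 - α) * (‖x‖ ^ 2 - inner ℝ a x ^ 2) + inner ℝ a x) +
        ((1 - α) / 32) ^ 2 * (‖x‖ ^ 2 - inner ℝ a x ^ 2)) / ‖x‖ ^ 2) * ‖v‖ ^ 2) := by ring
    _ ≤ _ := mul_le_mul_of_nonneg_left key zero_le_two
    _ = _ := by ring

theorem not_convex_lens {a e : E} (ha : ‖a‖ = 1) (he : ‖e‖ = 1) (hae : inner ℝ a e = 0) {k : ℝ}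
    (hk : k ≠ 0) : ¬ Convex ℝ {x | lensFunction a k x < 0} := by
  intro hc
  have hval : ∀ s t : ℝ, lensFunction a k (s • e + t • a) =
      (t - 1 + k / 2 * s ^ 2) ^ 2 + (k / 32) ^ 2 * s ^ 2 - (k / 256) ^ 2 := by
    intro s t
    have h1 : inner ℝ a (s • e + t • a) = t := by
      rw [inner_add_right, real_inner_smul_right, real_inner_smul_right, hae,
        real_inner_self_eq_norm_sq, ha]
      ring
    have h2 : ‖s • e + t • a‖ ^ 2 = s ^ 2 + t ^ 2 := by
      rw [norm_add_sq_real, real_inner_smul_right, real_inner_smul_left, real_inner_comm, hae,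
        norm_smul, norm_smul, he, ha, mul_one, mul_one, Real.norm_eq_abs, Real.norm_eq_abs,
        sq_abs, sq_abs]
      ring
    simp only [lensFunction, lensHeight, h1, h2]
    ring
  -- With `s² = 1/128` the bending `k s² / 2` cancels the drop `k/256`: both points have `u = 0` and
  -- lie inside, while their midpoint is the inner pole, on the zero level.
  set s := Real.sqrt (1 / 128) with hs
  have hs2 : s ^ 2 = 1 / 128 := Real.sq_sqrt (by norm_num)
  have hk2 : 0 < k ^ 2 := by positivity
  have hmem : ∀ σ : ℝ, σ ^ 2 = 1 / 128 →
      σ • e + (1 - k / 256) • a ∈ {x | lensFunction a k x < 0} := by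
    intro σ hσ
    rw [Set.mem_ofPred_eq, hval, hσ]
    nlinarith
  have hmid := hc (hmem s hs2) (hmem (-s) (by rw [neg_sq, hs2])) (a := 1 / 2) (b := 1 / 2)
    (by norm_num) (by norm_num) (by norm_num)
  have hmid' : (1 / 2 : ℝ) • (s • e + (1 - k / 256) • a) +
      (1 / 2 : ℝ) • (-s • e + (1 - k / 256) • a) = (0 : ℝ) • e + (1 - k / 256) • a := by module
  rw [hmid', Set.mem_ofPred_eq, hval] at hmid
  ring_nf at hmid
  exact lt_irrefl _ hmid

theorem exists_not_convex_domain [CompleteSpace E] {a e : E} (ha : ‖a‖ = 1) (he : ‖e‖ = 1)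
    (hae : inner ℝ a e = 0) {α : ℝ} (hα0 : 0 ≤ α) (hα1 : α < 1) :
    ∃ Ω : Set E, IsBoundedDomain ∞ Ω ∧ SatisfiesCondition α Ω ∧
      0 ∉ closure Ω ∧ ¬ Convex ℝ Ω := by
  have hk0 : 0 < 1 - α := by linarith
  refine ⟨{x | lensFunction a (1 - α) x < 0},
    isBoundedDomain_sublevel (lensFunction_contDiff a _)
      (fun x hx => fderiv_lensFunction_ne_zero ha hk0.ne' hx) (isConnected_lens ha hk0.ne')
      (isBounded_lens ha hk0 (by linarith)),
    satisfiesCondition_lens ha hα0 hα1, fun h => ?_, not_convex_lens ha he hae hk0.ne'⟩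
  -- The value at the origin is `1 - (k/256)² > 0`.
  have h1 : lensFunction a (1 - α) 0 ≤ 0 :=
    closure_lt_subset_le (lensFunction_contDiff (n := 0) a _).continuous continuous_const h
  simp only [lensFunction, lensHeight, inner_zero_right, norm_zero] at h1
  nlinarith

end CurvatureCondition


theorem proposition1p3 (d : ℕ) (hd : 3 ≤ d) (α : ℝ) (hα0 : 0 < α) (hα1 : α < 1) :
    (∀ Ω : Set (EuclideanSpace ℝ (Fin d)),
      CurvatureCondition.IsBoundedDomain 2 Ω → CurvatureCondition.SatisfiesCondition α Ω →
        0 ∈ Ω → Convex ℝ Ω) ∧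
    (∃ Ω : Set (EuclideanSpace ℝ (Fin d)),
      CurvatureCondition.IsBoundedDomain ∞ Ω ∧ CurvatureCondition.SatisfiesCondition α Ω ∧
        0 ∉ closure Ω ∧ Convex ℝ Ω) ∧
    (∃ Ω : Set (EuclideanSpace ℝ (Fin d)),
      CurvatureCondition.IsBoundedDomain ∞ Ω ∧ CurvatureCondition.SatisfiesCondition α Ω ∧
        0 ∉ closure Ω ∧ ¬ Convex ℝ Ω) := by
  have hb := (EuclideanSpace.basisFun (Fin d) ℝ).orthonormal
  have hne : (⟨0, by omega⟩ : Fin d) ≠ ⟨1, by omega⟩ := by simp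
  exact ⟨fun Ω hΩ hc h0 => hΩ.convex_of_satisfiesCondition hα1.le hc h0,
    CurvatureCondition.exists_convex_domain (hb.1 ⟨0, by omega⟩) hα0.le hα1.le,
    CurvatureCondition.exists_not_convex_domain (hb.1 ⟨0, by omega⟩) (hb.1 ⟨1, by omega⟩)
      (hb.2 hne) hα0.le hα1⟩
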